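/- Fix $n\in\mathbb N$, $R,\kappa\in\mathbb R$ and $\alpha_{\min}\in(0,\infty)$. An adversary chooses a random sequence of clustering instances on $n$ points; the $t$-th instance is given by a random symmetric distance matrix $D^{(t)}=(d^{(t)}_{ij})\in[0,R]^{n\times n}$. Suppose the distances are $\kappa$-smooth: for every $t$ and all $i<j$, conditionally on the matrices of the earlier rounds and on the other distances $d^{(t)}_{kl}$, $k<l$, of round $t$, the distance $d^{(t)}_{ij}$ has a density bounded by $\kappa$. (If all the distances $d^{(t)}_{ij}$, $t\ge1$, $i<j$, are independent, this just says that each of them has a density bounded by $\kappa$.) For $\alpha>\alpha_{\min}$ let the clustering algorithm with parameter $\alpha$ start from the $n$ singletons and repeatedly merge the pair of clusters $A,B$ with the smallest value of $$m^{1,\alpha}(A,B)=\Big(\min_{a\in A,b\in B}d(a,b)^\alpha+\max_{a\in A,b\in B}d(a,b)^\alpha\Big)^{1/\alpha},$$ ties being broken by an arbitrary ranking of the pairs of clusters that does not depend on $\alpha$, until one cluster is left. Let $u_1^{(t)}(\alpha)=v^{(t)}(\mathcal T^{(t)}_\alpha)$, where $\mathcal T^{(t)}_\alpha$ is the resulting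 cluster tree (the hierarchy of all the clusters that occur) for the distances $D^{(t)}$, and $v^{(t)}$ is an arbitrary function from cluster trees to $[0,1]$ that does not depend on $\alpha$ (the ranking and $v^{(t)}$ may depend on the round and on the random outcome). Then the sequence $u_1^{(1)},u_1^{(2)},\dots$ is $\tfrac12$-dispersed on $(\alpha_{\min},\infty)$, for every Lipschitz constant $L\ge0$ (in particular for $L=0$). That is, there are constants $C$ and $k$ depending only on $n,R,\kappa,\alpha_{\min}$ such that for every such adversary, all rankings and functions $v^{(t)}$, all $L\ge 0$, all integers $T\ge1$ and all $\varepsilon\ge T^{-1/2}$, $$\mathbb E\Big[\sup_{\substack{\alpha,\alpha'>\alpha_{\min}\\|\alpha-\alpha'|\le\varepsilon}}\#\big\{1\le t\le T:\ |u_1^{(t)}(\alpha)-u_1^{(t)}(\alpha')|>L|\alpha-\alpha'|\big\}\Big]\le C\,\varepsilon\,T\,(1+\log T)^k=\tilde O(\varepsilon T),$$ where $\mathbb E$ is the upper expectation (the infimum of the expectations of the measurable functions above the given one), so that no measurability of the supremum is presupposed. -/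

import Mathlib

open MeasureTheory ProbabilityTheory
open scoped ENNReal

noncomputable section

/-! ### Agglomerative hierarchical clustering with the merge functions `m^{1,α}` -/

/-- The merge function
`m^{1,α}(A, B) = (min_{a ∈ A, b ∈ B} d(a,b)^α + max_{a ∈ A, b ∈ B} d(a,b)^α)^(1/α)`.
The value `0` for empty `A` or `B` is never used: clusters are nonempty. -/
def mergeFun {n : ℕ} (d : Matrix (Fin n) (Fin n) ℝ) (α : ℝ) (A B : Finset (Fin n)) : ℝ :=
  if h : (A ×ˢ B).Nonempty then
    ((A ×ˢ B).inf' h (fun p => d p.1 p.2 ^ α) + (A ×ˢ B).sup' h (fun p => d p.1 p.2 ^ α))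
      ^ (1 / α)
  else 0

/-- A tie-breaking rule: a strict ranking of the pairs of clusters. -/
abbrev TieBreak (n : ℕ) := (Finset (Fin n) × Finset (Fin n)) ↪ ℕ

/-- One step of the algorithm on the current partition `P`: merge the pair of distinct clusters
of `P` with the smallest `m^{1,α}`, ties being broken by the ranking `tie`.
If `P` has at most one cluster, nothing happens. -/
def linkageStep {n : ℕ} (d : Matrix (Fin n) (Fin n) ℝ) (tie : TieBreak n) (α : ℝ)
    (P : Finset (Finset (Fin n))) : Finset (Finset (Fin n)) :=
  if h : P.offDiag.Nonempty then
    let p := (Finset.exists_min_image P.offDiag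
      (fun p => toLex (mergeFun d α p.1 p.2, tie p)) h).choose
    insert (p.1 ∪ p.2) ((P.erase p.1).erase p.2)
  else P

/-- The partition after `k` merges, starting from the singletons. -/
def linkagePartition {n : ℕ} (d : Matrix (Fin n) (Fin n) ℝ) (tie : TieBreak n) (α : ℝ)
    (k : ℕ) : Finset (Finset (Fin n)) :=
  (linkageStep d tie α)^[k] (Finset.univ.image fun i => {i})

/-- A hierarchical cluster tree on `n` points, given by the set of its nodes, each node being the
set of the points below it. -/
abbrev ClusterTree (n : ℕ) := Finset (Finset (Fin n))

/-- The cluster tree built by the algorithm: its nodes are the clusters that occur during the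
`n - 1` merges. -/
def linkageTree {n : ℕ} (d : Matrix (Fin n) (Fin n) ℝ) (tie : TieBreak n) (α : ℝ) :
    ClusterTree n :=
  (Finset.range n).biUnion (linkagePartition d tie α)

/-- The utility `u_1`, as a function of the parameter `α`: the value in `[0,1]`, under the
evaluation `v` of cluster trees, of the tree built with `m^{1,α}`. -/
def linkageUtility {n : ℕ} (d : Matrix (Fin n) (Fin n) ℝ) (tie : TieBreak n)
    (v : ClusterTree n → Set.Icc (0 : ℝ) 1) (α : ℝ) : ℝ :=
  v (linkageTree d tie α)

/-! ### Dispersion -/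

/-- The upper expectation of `f`: the infimum of the expectations of the measurable functions
above `f`. It is the expectation if `f` is measurable. -/
def upperExpectation {Ω : Type*} [MeasurableSpace Ω] (P : Measure Ω) (f : Ω → ℝ≥0∞) : ℝ≥0∞ :=
  ⨅ (g : Ω → ℝ≥0∞) (_ : Measurable g) (_ : ∀ ω, f ω ≤ g ω), ∫⁻ ω, g ω ∂P

/-- The number of functions among the first `T` that violate the `L`-Lipschitz inequality for the
pair `x, y`. -/
def lipschitzViolations {X : Type*} [PseudoMetricSpace X] (l : ℕ → X → ℝ) (L : ℝ) (T : ℕ)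
    (x y : X) : ℕ :=
  {t : ℕ | t < T ∧ L * dist x y < |l t x - l t y|}.ncard

/-- The sequence of random functions `l 0, l 1, …` on the domain `S` is `β`-dispersed for the
Lipschitz constant `L`, with the soft-O bound `C ε T (1 + log T)^k`: for all `T ≥ 1` and
`ε ≥ T^(-β)`, the expected maximum, over the pairs of points of `S` at distance at most `ε`, of the
number of functions among the first `T` that are not `L`-Lipschitz for the pair, is at most
`C ε T (1 + log T)^k`. (`β`-dispersed means that this holds for some constants `C` and `k`.) -/
def IsDispersedWith {Ω X : Type*} [MeasurableSpace Ω] [PseudoMetricSpace X] (P : Measure Ω)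
    (S : Set X) (l : ℕ → Ω → X → ℝ) (β L C : ℝ) (k : ℕ) : Prop :=
  ∀ T : ℕ, 1 ≤ T → ∀ ε : ℝ, (T : ℝ) ^ (-β) ≤ ε →
    upperExpectation P (fun ω =>
      ⨆ (x ∈ S) (y ∈ S) (_ : dist x y ≤ ε),
        (lipschitzViolations (fun t => l t ω) L T x y : ℝ≥0∞))
      ≤ ENNReal.ofReal (C * ε * T * (1 + Real.log T) ^ k)

/-! ### Smooth adversaries -/

/-- The σ-algebra generated by the distances `d^(s)_{kl}`, `k < l`, of all earlier rounds `s < t`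
and by all distances `d^(t)_{kl}`, `k < l`, of round `t` other than `d^(t)_{ij}`. -/
@[reducible] def otherDistances {Ω : Type*} {n : ℕ} (D : ℕ → Ω → Matrix (Fin n) (Fin n) ℝ) (t : ℕ)
    (i j : Fin n) : MeasurableSpace Ω :=
  ⨆ q ∈ {q : ℕ × Fin n × Fin n | q.2.1 < q.2.2 ∧ (q.1 < t ∨ (q.1 = t ∧ q.2 ≠ (i, j)))},
    MeasurableSpace.comap (fun ω => D q.1 ω q.2.1 q.2.2) inferInstance

/-- A random sequence of symmetric distance matrices in `[0,R]^{n×n}` whose entries are `κ`-smooth: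
given the earlier rounds and the other distances of the same round, the distance `d^(t)_{ij}` has
density at most `κ`. If all the distances `d^(t)_{ij}`, `i < j`, are independent, this says that
each of them has a density bounded by `κ`. -/
structure IsSmoothAdversary {Ω : Type*} [MeasurableSpace Ω] (P : Measure Ω) {n : ℕ}
    (D : ℕ → Ω → Matrix (Fin n) (Fin n) ℝ) (R κ : ℝ) : Prop where
  measurable : ∀ t i j, Measurable fun ω => D t ω i j
  symm : ∀ t ω, (D t ω).IsSymm
  mem_Icc : ∀ t ω i j, D t ω i j ∈ Set.Icc 0 R
  smooth : ∀ t i j, i < j → ∀ B : Set ℝ, MeasurableSet B →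
    ∀ E : Set Ω, MeasurableSet[otherDistances D t i j] E →
      P ({ω | D t ω i j ∈ B} ∩ E) ≤ ENNReal.ofReal κ * volume B * P E

end

/-!
Put `u = 1/α ∈ (0, 1/αmin)`. For a fixed pair of clusters, with smallest and largest distances
`x` and `y`, the merge value `N_u = (x^(1/u) + y^(1/u))^u` is increasing in `u`, and `2^(-u) N_u`
is decreasing in `u`. If two parameters lead to different trees, then, at the first step at
which the partitions differ, the merge values of two different pairs of clusters come in one order
for the first parameter and in the other order for the second. Hence at every `u₁` above both
inverse parameters, by at most `h`, the two merge values agree up to a factor `2^h`: the distance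
matrix has a *near tie* (`linkageTree_eq_of_not_hasNearTie`). Roots of
`x^α + y^α = x'^α + y'^α` as functions of `α` need not be considered, and ties at the
parameters themselves do no harm.

A near tie involves two pairs of points `e₁, e₂` and two others `f₁, f₂`, different from them since
clusters are disjoint. If `e₁` is the longer one of `e₁, e₂`, then its length lies in a window of
size at most `4hR` whose position is a function of the other three lengths
(`NearTie.mem_Icc_windowStart`). By smoothness a near tie has conditional probability `O(h)`, given
the earlier rounds (`IsSmoothAdversary.measure_hasNearTie_inter_le`).

If `|α - α'| ≤ ε`, then `1/α` and `1/α'` differ by at most `w = ε/αmin²`, so they lie in one of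
`O(1/ε)` cells `[kw, (k+2)w]` (`exists_cell`), and it suffices to bound the expectation of the
maximum over the cells of the number `N` of near ties. Since the near ties of a cell have
conditional probability at most `p = O(ε)` given the past, `𝔼 2^N ≤ (1 + p)^T`, and
`N ≤ a + 2^(N-a)` gives `O(pT + log(1/ε))` for the expected maximum
(`upperExpectation_le_of_le_occurrences`). This is `O(εT (1 + log T))`, as `εT ≥ 1`.
-/

noncomputable section

/-! ### Near ties -/

/-- The power sums `x₁^α + x₂^α` and `y₁^α + y₂^α` agree up to a factor `2^(hα)`; equivalently,
the values `(x₁^α + x₂^α)^(1/α)` and `(y₁^α + y₂^α)^(1/α)` agree up to a factor `2^h`. -/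
def NearTie (α h x₁ x₂ y₁ y₂ : ℝ) : Prop :=
  x₁ ^ α + x₂ ^ α ≤ 2 ^ (h * α) * (y₁ ^ α + y₂ ^ α) ∧
    y₁ ^ α + y₂ ^ α ≤ 2 ^ (h * α) * (x₁ ^ α + x₂ ^ α)

lemma NearTie.swap_left {α h x₁ x₂ y₁ y₂ : ℝ} (H : NearTie α h x₁ x₂ y₁ y₂) :
    NearTie α h x₂ x₁ y₁ y₂ := by
  unfold NearTie at *
  rwa [add_comm (x₂ ^ α)]

lemma rpow_add_rpow_le_two_rpow_mul {a b r : ℝ} (ha : 0 ≤ a) (hb : 0 ≤ b) (hr : 0 ≤ r)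
    (hr1 : r ≤ 1) : a ^ r + b ^ r ≤ 2 ^ (1 - r) * (a + b) ^ r := by
  have h := (Real.concaveOn_rpow hr hr1).2 (Set.mem_Ici.2 ha) (Set.mem_Ici.2 hb)
    (by norm_num : (0 : ℝ) ≤ 1 / 2) (by norm_num : (0 : ℝ) ≤ 1 / 2) (by norm_num)
  simp only [smul_eq_mul] at h
  rw [← mul_add, ← mul_add, Real.mul_rpow (by norm_num) (by positivity),
    Real.div_rpow (by norm_num) (by norm_num), Real.one_rpow] at h
  rw [Real.rpow_sub (by norm_num), Real.rpow_one]
  calc a ^ r + b ^ r = 2 * (1 / 2 * (a ^ r + b ^ r)) := by ring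
    _ ≤ 2 * (1 / 2 ^ r * (a + b) ^ r) := by gcongr
    _ = _ := by ring

/-- An inequality between power sums with exponent `α` persists at a smaller exponent `α₀`, up to
the factor `2^(hα₀)`: as functions of `u = 1/α`, the `ℓ^(1/u)`-norm is increasing and the
`1/u`-power mean is decreasing, and they differ by the factor `2^u`. -/
lemma rpow_add_rpow_le_of_le_exponent {α₀ α h x₁ x₂ y₁ y₂ : ℝ} (hα₀ : 0 < α₀) (hα : α₀ ≤ α)
    (hh : 1 / α₀ ≤ 1 / α + h) (hx₁ : 0 ≤ x₁) (hx₂ : 0 ≤ x₂) (hy₁ : 0 ≤ y₁) (hy₂ : 0 ≤ y₂)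
    (hle : x₁ ^ α + x₂ ^ α ≤ y₁ ^ α + y₂ ^ α) :
    x₁ ^ α₀ + x₂ ^ α₀ ≤ 2 ^ (h * α₀) * (y₁ ^ α₀ + y₂ ^ α₀) := by
  have hα' : 0 < α := hα₀.trans_le hα
  have hr : 0 ≤ α₀ / α := by positivity
  have hr1 : α₀ / α ≤ 1 := (div_le_one hα').2 hα
  have hpow : ∀ x : ℝ, 0 ≤ x → x ^ α₀ = (x ^ α) ^ (α₀ / α) := fun x hx => by
    rw [← Real.rpow_mul hx, mul_div_cancel₀ _ hα'.ne']
  have hexp : 1 - α₀ / α ≤ h * α₀ := by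
    have := mul_le_mul_of_nonneg_right hh hα₀.le
    rw [one_div_mul_cancel hα₀.ne', add_mul, one_div_mul_eq_div] at this
    linarith
  rw [hpow x₁ hx₁, hpow x₂ hx₂, hpow y₁ hy₁, hpow y₂ hy₂]
  calc _ ≤ (2 : ℝ) ^ (1 - α₀ / α) * (x₁ ^ α + x₂ ^ α) ^ (α₀ / α) :=
        rpow_add_rpow_le_two_rpow_mul (by positivity) (by positivity) hr hr1
    _ ≤ 2 ^ (h * α₀) * (y₁ ^ α + y₂ ^ α) ^ (α₀ / α) := by
        gcongr
        norm_num
    _ ≤ _ := by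
        gcongr
        exact Real.rpow_add_le_add_rpow (by positivity) (by positivity) hr hr1

lemma le_add_of_rpow_le_two_rpow_mul {α h x a R : ℝ} (hα : 0 < α) (hh : 0 ≤ h) (hx : 0 ≤ x)
    (ha : 0 ≤ a) (hxR : x ≤ R) (hle : x ^ α ≤ (2 ^ (h * α)) ^ 4 * a ^ α) :
    x ≤ a + 4 * h * R := by
  have h1 : x ≤ 2 ^ (4 * h) * a := by
    rw [← Real.rpow_le_rpow_iff hx (by positivity) hα, Real.mul_rpow (by positivity) ha,
      ← Real.rpow_mul (by norm_num)]
    rw [← Real.rpow_natCast, ← Real.rpow_mul (by norm_num)] at hle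
    convert hle using 3
    push_cast; ring
  -- `2^(-4h) = exp(-4h log 2) ≥ 1 - 4h log 2 ≥ 1 - 4h`
  have h2 : 1 - 4 * h ≤ (2 : ℝ) ^ (-(4 * h)) := by
    rw [Real.rpow_def_of_pos (by norm_num)]
    have := Real.add_one_le_exp (Real.log 2 * -(4 * h))
    have hl : Real.log 2 ≤ 1 := by linarith [Real.log_two_lt_d9]
    nlinarith
  have h3 : (2 : ℝ) ^ (-(4 * h)) * x ≤ a := by
    rw [Real.rpow_neg (by norm_num), inv_mul_le_iff₀ (by positivity)]
    exact h1
  nlinarith [mul_le_mul_of_nonneg_right h2 hx, mul_le_mul_of_nonneg_left hxR hh]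

/-- Left end of the window which contains the larger entry `x₁` of a near tie, as a function of
the other three entries. -/
def windowStart (α h x₂ y₁ y₂ : ℝ) : ℝ :=
  max (x₂ ^ α) ((y₁ ^ α + y₂ ^ α) / 2 ^ (h * α) - x₂ ^ α) ^ (1 / α)

/-- Left end of the window which contains `x` when `x₁ = x₂ = x` in a near tie. -/
def windowStartDiag (α h y₁ y₂ : ℝ) : ℝ :=
  ((y₁ ^ α + y₂ ^ α) / (2 * 2 ^ (h * α))) ^ (1 / α)

lemma NearTie.mem_Icc_windowStart {α h x₁ x₂ y₁ y₂ R : ℝ} (H : NearTie α h x₁ x₂ y₁ y₂)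
    (hα : 0 < α) (hh : 0 ≤ h) (hx₂ : 0 ≤ x₂) (hx : x₂ ≤ x₁) (hxR : x₁ ≤ R) :
    x₁ ∈ Set.Icc (windowStart α h x₂ y₁ y₂) (windowStart α h x₂ y₁ y₂ + 4 * h * R) := by
  obtain ⟨H1, H2⟩ := H
  have hx₁ : 0 ≤ x₁ := hx₂.trans hx
  have hQ : (1 : ℝ) ≤ 2 ^ (h * α) := Real.one_le_rpow (by norm_num) (by positivity)
  have hpow : x₂ ^ α ≤ x₁ ^ α := Real.rpow_le_rpow hx₂ hx hα.le
  have hX₂ : 0 ≤ x₂ ^ α := by positivity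
  have hm : 0 ≤ max (x₂ ^ α) ((y₁ ^ α + y₂ ^ α) / 2 ^ (h * α) - x₂ ^ α) := le_max_of_le_left hX₂
  constructor
  · unfold windowStart
    rw [one_div, Real.rpow_inv_le_iff_of_pos hm hx₁ hα]
    refine max_le hpow ?_
    rw [sub_le_iff_le_add, div_le_iff₀ (by positivity)]
    linarith
  · refine le_add_of_rpow_le_two_rpow_mul hα hh hx₁ (Real.rpow_nonneg hm _) hxR ?_
    unfold windowStart
    rw [one_div, Real.rpow_inv_rpow hm hα.ne']
    set Q : ℝ := 2 ^ (h * α)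
    set a := max (x₂ ^ α) ((y₁ ^ α + y₂ ^ α) / Q - x₂ ^ α)
    have ha1 : x₂ ^ α ≤ a := le_max_left _ _
    have ha2 : y₁ ^ α + y₂ ^ α ≤ Q * (a + x₂ ^ α) := by
      have := le_max_right (x₂ ^ α) ((y₁ ^ α + y₂ ^ α) / Q - x₂ ^ α)
      rw [sub_le_iff_le_add, div_le_iff₀ (by positivity)] at this
      linarith
    have h1 : x₁ ^ α + x₂ ^ α ≤ Q ^ 2 * (a + x₂ ^ α) := by
      calc _ ≤ _ := H1
        _ ≤ Q * (Q * (a + x₂ ^ α)) := by gcongr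
        _ = _ := by ring
    -- `x₁ ^ α ≤ Q² a + (Q² - 1) x₂ ^ α ≤ (2 Q² - 1) a ≤ Q⁴ a`, by `x₂ ^ α ≤ a` and `1 ≤ Q`
    have hQ2 : 1 ≤ Q ^ 2 := one_le_pow₀ hQ
    nlinarith [mul_nonneg (sub_nonneg.2 hQ2) (sub_nonneg.2 ha1),
      mul_nonneg (sq_nonneg (Q ^ 2 - 1)) (hX₂.trans ha1)]

lemma NearTie.mem_Icc_windowStartDiag {α h x y₁ y₂ R : ℝ} (H : NearTie α h x x y₁ y₂)
    (hα : 0 < α) (hh : 0 ≤ h) (hx : 0 ≤ x) (hy₁ : 0 ≤ y₁) (hy₂ : 0 ≤ y₂) (hxR : x ≤ R) :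
    x ∈ Set.Icc (windowStartDiag α h y₁ y₂) (windowStartDiag α h y₁ y₂ + 4 * h * R) := by
  obtain ⟨H1, H2⟩ := H
  have hm : 0 ≤ (y₁ ^ α + y₂ ^ α) / (2 * 2 ^ (h * α)) := by positivity
  constructor
  · unfold windowStartDiag
    rw [one_div, Real.rpow_inv_le_iff_of_pos hm hx hα, div_le_iff₀ (by positivity)]
    linarith
  · refine le_add_of_rpow_le_two_rpow_mul hα hh hx (Real.rpow_nonneg hm _) hxR ?_
    unfold windowStartDiag
    rw [one_div, Real.rpow_inv_rpow hm hα.ne']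
    have hQ : (1 : ℝ) ≤ 2 ^ (h * α) := Real.one_le_rpow (by norm_num) (by positivity)
    calc x ^ α ≤ 2 ^ (h * α) * (y₁ ^ α + y₂ ^ α) / 2 := by linarith
      _ = (2 ^ (h * α)) ^ 2 * ((y₁ ^ α + y₂ ^ α) / (2 * 2 ^ (h * α))) := by field_simp
      _ ≤ (2 ^ (h * α)) ^ 4 * ((y₁ ^ α + y₂ ^ α) / (2 * 2 ^ (h * α))) := by
        gcongr
        norm_num

/-! ### Change of the cluster tree forces a near tie -/

variable {n : ℕ}


/-- The pair `{i, j}` of points as an increasing pair of indices. -/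
def sortedPair (p : Fin n × Fin n) : Fin n × Fin n := (min p.1 p.2, max p.1 p.2)

lemma sortedPair_lt {p : Fin n × Fin n} (h : p.1 ≠ p.2) :
    (sortedPair p).1 < (sortedPair p).2 := by
  simpa [sortedPair] using h.symm

lemma sortedPair_eq_iff {p q : Fin n × Fin n} :
    sortedPair p = sortedPair q ↔ p = q ∨ p = q.swap := by
  obtain ⟨a, b⟩ := p
  obtain ⟨c, d⟩ := q
  simp only [sortedPair, Prod.mk.injEq, Prod.swap_prod_mk]
  constructor
  · rintro ⟨h1, h2⟩
    rcases le_total a b with h | h <;> rcases le_total c d with h' | h' <;>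
      simp_all
  · rintro (⟨rfl, rfl⟩ | ⟨rfl, rfl⟩)
    · simp
    · exact ⟨min_comm _ _, max_comm _ _⟩

lemma apply_sortedPair {d : Matrix (Fin n) (Fin n) ℝ} (hd : d.IsSymm) (p : Fin n × Fin n) :
    d (sortedPair p).1 (sortedPair p).2 = d p.1 p.2 := by
  rcases le_total p.1 p.2 with h | h
  · simp [sortedPair, h]
  · simp [sortedPair, h, hd.apply]

/-- The pairs of points at which the minimum and the maximum are attained do not depend
on `α`. -/
lemma exists_mergeFun_eq {d : Matrix (Fin n) (Fin n) ℝ} (hd : ∀ i j, 0 ≤ d i j)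
    {A B : Finset (Fin n)} (hA : A.Nonempty) (hB : B.Nonempty) :
    ∃ e ∈ A ×ˢ B, ∃ f ∈ A ×ˢ B, ∀ α : ℝ, 0 < α →
      mergeFun d α A B = (d e.1 e.2 ^ α + d f.1 f.2 ^ α) ^ (1 / α) := by
  have h : (A ×ˢ B).Nonempty := hA.product hB
  obtain ⟨e, he, he'⟩ := (A ×ˢ B).exists_min_image (fun p => d p.1 p.2) h
  obtain ⟨f, hf, hf'⟩ := (A ×ˢ B).exists_max_image (fun p => d p.1 p.2) h
  refine ⟨e, he, f, hf, fun α hα => ?_⟩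
  rw [mergeFun, dif_pos h]
  congr 2
  · exact le_antisymm (Finset.inf'_le _ he) (Finset.le_inf' _ _ fun p hp =>
      Real.rpow_le_rpow (hd _ _) (he' p hp) hα.le)
  · exact le_antisymm (Finset.sup'_le _ _ fun p hp =>
      Real.rpow_le_rpow (hd _ _) (hf' p hp) hα.le) (Finset.le_sup' (fun p => d p.1 p.2 ^ α) hf)

/-- A partial partition: pairwise disjoint nonempty clusters. -/
def IsClustering (P : Finset (Finset (Fin n))) : Prop :=
  (∀ A ∈ P, A.Nonempty) ∧ ∀ A ∈ P, ∀ B ∈ P, A ≠ B → Disjoint A B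

lemma linkageStep_spec (d : Matrix (Fin n) (Fin n) ℝ) (tie : TieBreak n) (α : ℝ)
    {P : Finset (Finset (Fin n))} (h : P.offDiag.Nonempty) :
    ∃ p ∈ P.offDiag, (∀ q ∈ P.offDiag, mergeFun d α p.1 p.2 ≤ mergeFun d α q.1 q.2) ∧
      linkageStep d tie α P = insert (p.1 ∪ p.2) ((P.erase p.1).erase p.2) := by
  have hs := (Finset.exists_min_image P.offDiag
      (fun p => toLex (mergeFun d α p.1 p.2, tie p)) h).choose_spec
  refine ⟨_, hs.1, fun q hq => ?_, by rw [linkageStep, dif_pos h]⟩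
  have := hs.2 q hq
  rw [Prod.Lex.toLex_le_toLex] at this
  rcases this with h | h
  · exact h.le
  · exact h.1.le

lemma IsClustering.linkageStep {P : Finset (Finset (Fin n))} (hP : IsClustering P)
    (d : Matrix (Fin n) (Fin n) ℝ) (tie : TieBreak n) (α : ℝ) :
    IsClustering (linkageStep d tie α P) := by
  by_cases h : P.offDiag.Nonempty
  · obtain ⟨p, hp, -, heq⟩ := linkageStep_spec d tie α h
    rw [heq]
    rw [Finset.mem_offDiag] at hp
    have hdisj : ∀ A ∈ (P.erase p.1).erase p.2, Disjoint (p.1 ∪ p.2) A := fun A hA => by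
      simp only [Finset.mem_erase] at hA
      rw [Finset.disjoint_union_left]
      exact ⟨hP.2 _ hp.1 _ hA.2.2 (Ne.symm hA.2.1), hP.2 _ hp.2.1 _ hA.2.2 (Ne.symm hA.1)⟩
    constructor
    · intro A hA
      rcases Finset.mem_insert.1 hA with rfl | hA
      · exact (hP.1 _ hp.1).mono Finset.subset_union_left
      · exact hP.1 _ (Finset.mem_of_mem_erase (Finset.mem_of_mem_erase hA))
    · intro A hA B hB hAB
      rcases Finset.mem_insert.1 hA with rfl | hA <;> rcases Finset.mem_insert.1 hB with rfl | hB
      · exact absurd rfl hAB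
      · exact hdisj _ hB
      · exact (hdisj _ hA).symm
      · exact hP.2 _ (Finset.mem_of_mem_erase (Finset.mem_of_mem_erase hA)) _
          (Finset.mem_of_mem_erase (Finset.mem_of_mem_erase hB)) hAB
  · rwa [_root_.linkageStep, dif_neg h]

lemma linkagePartition_succ (d : Matrix (Fin n) (Fin n) ℝ) (tie : TieBreak n) (α : ℝ) (k : ℕ) :
    linkagePartition d tie α (k + 1) = linkageStep d tie α (linkagePartition d tie α k) := by
  simp only [linkagePartition, Function.iterate_succ_apply']

lemma isClustering_linkagePartition (d : Matrix (Fin n) (Fin n) ℝ) (tie : TieBreak n) (α : ℝ)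
    (k : ℕ) : IsClustering (linkagePartition d tie α k) := by
  induction k with
  | zero =>
    simp only [linkagePartition, Function.iterate_zero, id_eq]
    constructor
    · simp
    · simp [eq_comm]
  | succ k ih =>
    rw [linkagePartition_succ]
    exact ih.linkageStep d tie α

/-- In a clustering, two different pairs of clusters do not share any pair of points. -/
lemma IsClustering.sortedPair_ne {P : Finset (Finset (Fin n))} (hP : IsClustering P)
    {p q : Finset (Fin n) × Finset (Fin n)} (hp : p ∈ P.offDiag) (hq : q ∈ P.offDiag)
    (hpq : p ≠ q) (hpq' : p ≠ q.swap) {e f : Fin n × Fin n} (he : e ∈ p.1 ×ˢ p.2)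
    (hf : f ∈ q.1 ×ˢ q.2) : sortedPair e ≠ sortedPair f := by
  rw [Finset.mem_offDiag] at hp hq
  rw [Finset.mem_product] at he hf
  have key : ∀ A ∈ P, ∀ B ∈ P, ∀ x ∈ A, x ∈ B → A = B := fun A hA B hB x hxA hxB => by
    by_contra hne
    exact Finset.disjoint_left.1 (hP.2 A hA B hB hne) hxA hxB
  rw [Ne, sortedPair_eq_iff]
  rintro (rfl | rfl)
  · exact hpq (Prod.ext (key _ hp.1 _ hq.1 _ he.1 hf.1) (key _ hp.2.1 _ hq.2.1 _ he.2 hf.2))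
  · exact hpq' (Prod.ext (key _ hp.1 _ hq.2.1 _ he.1 hf.2) (key _ hp.2.1 _ hq.1 _ he.2 hf.1))

/-- The quadruples `((e₁, e₂), (f₁, f₂))` of pairs of points `i < j` such that `e₁, e₂` both
differ from `f₁, f₂`; `e₁ = e₂` and `f₁ = f₂` are allowed, since the minimum and the maximum of the
distances between two clusters can be attained at the same pair. -/
def pairQuadruples (n : ℕ) :
    Finset (((Fin n × Fin n) × (Fin n × Fin n)) × ((Fin n × Fin n) × (Fin n × Fin n))) :=
  Finset.univ.filter fun q =>
    (q.1.1.1 < q.1.1.2 ∧ q.1.2.1 < q.1.2.2 ∧ q.2.1.1 < q.2.1.2 ∧ q.2.2.1 < q.2.2.2) ∧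
      q.1.1 ≠ q.2.1 ∧ q.1.1 ≠ q.2.2 ∧ q.1.2 ≠ q.2.1 ∧ q.1.2 ≠ q.2.2

/-- Some two distances and two other distances form a near tie. -/
def HasNearTie (α h : ℝ) (d : Matrix (Fin n) (Fin n) ℝ) : Prop :=
  ∃ q ∈ pairQuadruples n, NearTie α h (d q.1.1.1 q.1.1.2) (d q.1.2.1 q.1.2.2)
    (d q.2.1.1 q.2.1.2) (d q.2.2.1 q.2.2.2)

/-- If the pairs merged for `α` and `β` differ, then the two merge values come in one order
at `α` and in the other order at `β`, so they are close to each other at `α₀`. -/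
lemma IsClustering.linkageStep_eq {P : Finset (Finset (Fin n))} (hP : IsClustering P)
    {d : Matrix (Fin n) (Fin n) ℝ} (hd : ∀ i j, 0 ≤ d i j) (hsymm : d.IsSymm) (tie : TieBreak n)
    {α₀ h α β : ℝ} (hα₀ : 0 < α₀) (hα : α₀ ≤ α) (hβ : α₀ ≤ β) (hhα : 1 / α₀ ≤ 1 / α + h)
    (hhβ : 1 / α₀ ≤ 1 / β + h) (hno : ¬ HasNearTie α₀ h d) :
    _root_.linkageStep d tie α P = _root_.linkageStep d tie β P := by
  by_cases hne : P.offDiag.Nonempty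
  swap
  · rw [_root_.linkageStep, _root_.linkageStep, dif_neg hne, dif_neg hne]
  obtain ⟨p, hp, hpmin, hpeq⟩ := linkageStep_spec d tie α hne
  obtain ⟨q, hq, hqmin, hqeq⟩ := linkageStep_spec d tie β hne
  rw [hpeq, hqeq]
  by_cases hpq : p = q
  · rw [hpq]
  by_cases hpq' : p = q.swap
  · rw [hpq', Prod.fst_swap, Prod.snd_swap, Finset.union_comm, Finset.erase_right_comm]
  refine absurd ?_ hno
  have hα' := hα₀.trans_le hα
  have hβ' := hα₀.trans_le hβ
  have hp' := Finset.mem_offDiag.1 hp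
  have hq' := Finset.mem_offDiag.1 hq
  obtain ⟨e₁, he₁, e₂, he₂, he⟩ := exists_mergeFun_eq hd (hP.1 _ hp'.1) (hP.1 _ hp'.2.1)
  obtain ⟨f₁, hf₁, f₂, hf₂, hf⟩ := exists_mergeFun_eq hd (hP.1 _ hq'.1) (hP.1 _ hq'.2.1)
  have h1 := hpmin q hq
  have h2 := hqmin p hp
  have hpos : ∀ (e f : Fin n × Fin n) (γ : ℝ), 0 ≤ d e.1 e.2 ^ γ + d f.1 f.2 ^ γ := fun e f γ =>
    add_nonneg (Real.rpow_nonneg (hd _ _) _) (Real.rpow_nonneg (hd _ _) _)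
  rw [he α hα', hf α hα', Real.rpow_le_rpow_iff (hpos _ _ _) (hpos _ _ _) (by positivity)] at h1
  rw [he β hβ', hf β hβ', Real.rpow_le_rpow_iff (hpos _ _ _) (hpos _ _ _) (by positivity)] at h2
  have hoff : ∀ {r : Finset (Fin n) × Finset (Fin n)}, r ∈ P.offDiag →
      ∀ e ∈ r.1 ×ˢ r.2, e.1 ≠ e.2 := fun hr e he heq => by
    rw [Finset.mem_offDiag] at hr
    rw [Finset.mem_product] at he
    exact Finset.disjoint_left.1 (hP.2 _ hr.1 _ hr.2.1 hr.2.2) he.1 (heq ▸ he.2)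
  refine ⟨((sortedPair e₁, sortedPair e₂), (sortedPair f₁, sortedPair f₂)), ?_, ?_⟩
  · simp only [pairQuadruples, Finset.mem_filter, Finset.mem_univ, true_and]
    exact ⟨⟨sortedPair_lt (hoff hp _ he₁), sortedPair_lt (hoff hp _ he₂),
      sortedPair_lt (hoff hq _ hf₁), sortedPair_lt (hoff hq _ hf₂)⟩,
      hP.sortedPair_ne hp hq hpq hpq' he₁ hf₁, hP.sortedPair_ne hp hq hpq hpq' he₁ hf₂,
      hP.sortedPair_ne hp hq hpq hpq' he₂ hf₁, hP.sortedPair_ne hp hq hpq hpq' he₂ hf₂⟩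
  · simp only [apply_sortedPair hsymm]
    exact ⟨rpow_add_rpow_le_of_le_exponent hα₀ hα hhα (hd _ _) (hd _ _) (hd _ _) (hd _ _) h1,
      rpow_add_rpow_le_of_le_exponent hα₀ hβ hhβ (hd _ _) (hd _ _) (hd _ _) (hd _ _) h2⟩

lemma linkageTree_eq_of_not_hasNearTie {d : Matrix (Fin n) (Fin n) ℝ} (hd : ∀ i j, 0 ≤ d i j)
    (hsymm : d.IsSymm) (tie : TieBreak n) {α₀ h α β : ℝ} (hα₀ : 0 < α₀) (hα : α₀ ≤ α)
    (hβ : α₀ ≤ β) (hhα : 1 / α₀ ≤ 1 / α + h) (hhβ : 1 / α₀ ≤ 1 / β + h)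
    (hno : ¬ HasNearTie α₀ h d) : linkageTree d tie α = linkageTree d tie β := by
  have key : ∀ k, linkagePartition d tie α k = linkagePartition d tie β k := fun k => by
    induction k with
    | zero => simp only [linkagePartition, Function.iterate_zero]
    | succ k ih =>
      rw [linkagePartition_succ, linkagePartition_succ, ← ih,
        (isClustering_linkagePartition d tie α k).linkageStep_eq hd hsymm tie hα₀ hα hβ hhα hhβ hno]
  unfold linkageTree
  rw [funext key]

/-! ### Exponential moments of a count of conditionally rare events -/

section Counting

variable {Ω : Type*}

lemma setLIntegral_le_mul_lintegral {m m0 : MeasurableSpace Ω} {P : Measure Ω} (hm : m ≤ m0)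
    {A : Set Ω} {p : ℝ≥0∞} (hA : ∀ E, MeasurableSet[m] E → P (A ∩ E) ≤ p * P E)
    {f : Ω → ℝ≥0∞} (hf : Measurable[m] f) : ∫⁻ ω in A, f ω ∂P ≤ p * ∫⁻ ω, f ω ∂P := by
  have hle : (P.restrict A).trim hm ≤ p • P.trim hm := by
    refine Measure.le_iff.2 fun E hE => ?_
    rw [trim_measurableSet_eq hm hE, Measure.restrict_apply (hm _ hE), Measure.smul_apply,
      trim_measurableSet_eq hm hE, Set.inter_comm, smul_eq_mul]
    exact hA E hE
  calc ∫⁻ ω in A, f ω ∂P = ∫⁻ ω, f ω ∂(P.restrict A).trim hm := (lintegral_trim hm hf).symm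
    _ ≤ ∫⁻ ω, f ω ∂(p • P.trim hm) := lintegral_mono' hle le_rfl
    _ = p * ∫⁻ ω, f ω ∂P := by rw [lintegral_smul_measure, lintegral_trim hm hf, smul_eq_mul]

open Classical in
/-- The number of the events `A 0, …, A (T - 1)` that occur. -/
def occurrences (A : ℕ → Set Ω) (T : ℕ) (ω : Ω) : ℕ :=
  ((Finset.range T).filter fun t => ω ∈ A t).card

lemma two_pow_occurrences_succ (A : ℕ → Set Ω) (T : ℕ) (ω : Ω) :
    (2 : ℝ≥0∞) ^ occurrences A (T + 1) ω =
      2 ^ occurrences A T ω + (A T).indicator (fun ω => 2 ^ occurrences A T ω) ω := by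
  classical
  by_cases h : ω ∈ A T
  · simp [occurrences, Finset.range_add_one, Finset.filter_insert, h, pow_succ, mul_two]
  · simp [occurrences, Finset.range_add_one, Finset.filter_insert, h]

variable {m0 : MeasurableSpace Ω} {ℱ : Filtration ℕ m0} {A : ℕ → Set Ω}

lemma measurable_two_pow_occurrences (hA : ∀ t, MeasurableSet[ℱ (t + 1)] (A t)) (T : ℕ) :
    Measurable[ℱ T] fun ω => (2 : ℝ≥0∞) ^ occurrences A T ω := by
  induction T with
  | zero => simp [occurrences]
  | succ T ih =>
    simp only [two_pow_occurrences_succ]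
    have ih' := ih.mono (ℱ.mono T.le_succ) le_rfl
    exact ih'.add (ih'.indicator (hA T))

/-- If each event has probability at most `p` given the past, then the number of events that occur
has the exponential moment of independent events: `𝔼 2^N ≤ (1 + p)^T`. -/
lemma lintegral_two_pow_occurrences_le {P : Measure Ω} [IsProbabilityMeasure P] {p : ℝ≥0∞}
    (hA : ∀ t, MeasurableSet[ℱ (t + 1)] (A t))
    (hp : ∀ t E, MeasurableSet[ℱ t] E → P (A t ∩ E) ≤ p * P E) (T : ℕ) :
    ∫⁻ ω, 2 ^ occurrences A T ω ∂P ≤ (1 + p) ^ T := by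
  induction T with
  | zero => simp [occurrences]
  | succ T ih =>
    have hm := measurable_two_pow_occurrences hA T
    simp only [two_pow_occurrences_succ]
    rw [lintegral_add_left (hm.mono (ℱ.le T) le_rfl), lintegral_indicator (ℱ.le _ _ (hA T))]
    calc _ ≤ ∫⁻ ω, 2 ^ occurrences A T ω ∂P + p * ∫⁻ ω, 2 ^ occurrences A T ω ∂P := by
          gcongr
          exact setLIntegral_le_mul_lintegral (ℱ.le T) (hp T) hm
      _ = (1 + p) * ∫⁻ ω, 2 ^ occurrences A T ω ∂P := by ring
      _ ≤ (1 + p) * (1 + p) ^ T := by gcongr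
      _ = (1 + p) ^ (T + 1) := by ring

lemma natCast_le_add_two_pow_div (N a : ℕ) : (N : ℝ≥0∞) ≤ a + 2 ^ N / 2 ^ a := by
  rcases le_total N a with h | h
  · exact le_add_right (by exact_mod_cast h)
  · obtain ⟨m, rfl⟩ := Nat.exists_eq_add_of_le h
    rw [pow_add, ENNReal.mul_div_right_comm, ENNReal.div_self (by simp) (by simp), one_mul]
    exact_mod_cast Nat.add_le_add_left Nat.lt_two_pow_self.le a

lemma upperExpectation_le_lintegral {P : Measure Ω} {f g : Ω → ℝ≥0∞} (hg : Measurable g)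
    (hfg : ∀ ω, f ω ≤ g ω) : upperExpectation P f ≤ ∫⁻ ω, g ω ∂P :=
  iInf_le_of_le g (iInf_le_of_le hg (iInf_le_of_le hfg le_rfl))

/-- The upper expectation of the largest of `M` such counts is at most `a + 1` as soon as
`M (1 + p)^T ≤ 2^a`. -/
lemma upperExpectation_le_of_le_occurrences {P : Measure Ω} [IsProbabilityMeasure P] {p : ℝ≥0∞}
    {B : ℕ → ℕ → Set Ω} (hB : ∀ k t, MeasurableSet[ℱ (t + 1)] (B k t))
    (hp : ∀ k t E, MeasurableSet[ℱ t] E → P (B k t ∩ E) ≤ p * P E) {M T a : ℕ}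
    (ha : M * (1 + p) ^ T ≤ 2 ^ a) {f : Ω → ℝ≥0∞}
    (hf : ∀ ω, f ω ≤ ⨆ k ∈ Finset.range M, (occurrences (B k) T ω : ℝ≥0∞)) :
    upperExpectation P f ≤ a + 1 := by
  have hm : ∀ k, Measurable fun ω => (2 : ℝ≥0∞) ^ occurrences (B k) T ω / 2 ^ a := fun k =>
    ((measurable_two_pow_occurrences (hB k) T).mono (ℱ.le T) le_rfl).div_const _
  refine (upperExpectation_le_lintegral
    (g := fun ω => a + ∑ k ∈ Finset.range M, 2 ^ occurrences (B k) T ω / 2 ^ a)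
    (measurable_const.add (Finset.measurable_sum _ fun k _ => hm k)) (fun ω => ?_)).trans ?_
  · refine (hf ω).trans (iSup₂_le fun k hk => (natCast_le_add_two_pow_div _ a).trans ?_)
    gcongr
    exact Finset.single_le_sum (f := fun k => (2 : ℝ≥0∞) ^ occurrences (B k) T ω / 2 ^ a)
      (fun _ _ => zero_le) hk
  · rw [lintegral_add_left measurable_const, lintegral_const, measure_univ, mul_one,
      lintegral_finsetSum _ fun k _ => hm k]
    gcongr
    calc ∑ k ∈ Finset.range M, ∫⁻ ω, 2 ^ occurrences (B k) T ω / 2 ^ a ∂P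
        ≤ ∑ k ∈ Finset.range M, (1 + p) ^ T / 2 ^ a := by
          refine Finset.sum_le_sum fun k _ => ?_
          simp only [div_eq_mul_inv]
          rw [lintegral_mul_const _
            ((measurable_two_pow_occurrences (hB k) T).mono (ℱ.le T) le_rfl)]
          gcongr
          exact lintegral_two_pow_occurrences_le (hB k) (hp k) T
      _ = M * (1 + p) ^ T / 2 ^ a := by
          rw [Finset.sum_const, Finset.card_range, nsmul_eq_mul, mul_div_assoc]
      _ ≤ 1 := ENNReal.div_le_of_le_mul (by simpa using ha)

end Counting

/-! ### Near ties are unlikely -/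

lemma measurable_otherDistances {Ω : Type*} (D : ℕ → Ω → Matrix (Fin n) (Fin n) ℝ)
    (t : ℕ) {e f : Fin n × Fin n} (hf : f.1 < f.2) (hfe : f ≠ e) :
    Measurable[otherDistances D t e.1 e.2] fun ω => D t ω f.1 f.2 := by
  refine (comap_measurable _).mono ?_ le_rfl
  exact le_iSup₂_of_le (f := fun (q : ℕ × Fin n × Fin n)
    (_ : q ∈ {q : ℕ × Fin n × Fin n | q.2.1 < q.2.2 ∧ (q.1 < t ∨ (q.1 = t ∧ q.2 ≠ (e.1, e.2)))}) =>
      MeasurableSpace.comap (fun ω => D q.1 ω q.2.1 q.2.2) inferInstance)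
      (t, f) ⟨hf, Or.inr ⟨rfl, hfe⟩⟩ le_rfl

section Smooth

variable {Ω : Type*} [mΩ : MeasurableSpace Ω] {P : Measure Ω}
  {D : ℕ → Ω → Matrix (Fin n) (Fin n) ℝ} {R κ : ℝ}

/-- The filtration generated by the distances of the earlier rounds. -/
def IsSmoothAdversary.history (H : IsSmoothAdversary P D R κ) : Filtration ℕ mΩ where
  seq t := ⨆ q ∈ {q : ℕ × Fin n × Fin n | q.2.1 < q.2.2 ∧ q.1 < t},
    MeasurableSpace.comap (fun ω => D q.1 ω q.2.1 q.2.2) inferInstance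
  mono' _ _ hst := biSup_mono fun _ hq => ⟨hq.1, hq.2.trans_le hst⟩
  le' _ := iSup₂_le fun q _ => (H.measurable q.1 q.2.1 q.2.2).comap_le

lemma IsSmoothAdversary.otherDistances_le (H : IsSmoothAdversary P D R κ) (t : ℕ) (i j : Fin n) :
    otherDistances D t i j ≤ mΩ :=
  iSup₂_le fun q _ => (H.measurable q.1 q.2.1 q.2.2).comap_le

lemma IsSmoothAdversary.history_le_otherDistances (H : IsSmoothAdversary P D R κ) (t : ℕ)
    (i j : Fin n) : H.history t ≤ otherDistances D t i j :=
  biSup_mono fun _ hq => ⟨hq.1, Or.inl hq.2⟩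

lemma IsSmoothAdversary.measurable_history (H : IsSmoothAdversary P D R κ) (t : ℕ) {i j : Fin n}
    (hij : i < j) : Measurable[H.history (t + 1)] fun ω => D t ω i j := by
  refine (comap_measurable _).mono ?_ le_rfl
  exact le_iSup₂_of_le (f := fun (q : ℕ × Fin n × Fin n)
    (_ : q ∈ {q : ℕ × Fin n × Fin n | q.2.1 < q.2.2 ∧ q.1 < t + 1}) =>
      MeasurableSpace.comap (fun ω => D q.1 ω q.2.1 q.2.2) inferInstance)
      (t, i, j) ⟨hij, t.lt_succ_self⟩ le_rfl

/-- Smoothness for a window of fixed length whose position depends on the other distances: round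
the position down to a multiple of the length. -/
lemma IsSmoothAdversary.measure_mem_window_le (H : IsSmoothAdversary P D R κ) (t : ℕ)
    {i j : Fin n} (hij : i < j) {a : Ω → ℝ} (ha : Measurable[otherDistances D t i j] a) {ℓ : ℝ}
    (hℓ : 0 < ℓ) {E : Set Ω} (hE : MeasurableSet[otherDistances D t i j] E) :
    P ({ω | D t ω i j ∈ Set.Icc (a ω) (a ω + ℓ)} ∩ E) ≤
      ENNReal.ofReal κ * ENNReal.ofReal (2 * ℓ) * P E := by
  let G : ℤ → Set Ω := fun k => {ω | ⌊a ω / ℓ⌋ = k} ∩ E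
  have hG : ∀ k, MeasurableSet[otherDistances D t i j] (G k) := fun k =>
    MeasurableSet.inter (Int.measurable_floor.comp (ha.div_const ℓ) (measurableSet_singleton k)) hE
  have hsub : {ω | D t ω i j ∈ Set.Icc (a ω) (a ω + ℓ)} ∩ E ⊆
      ⋃ k : ℤ, {ω | D t ω i j ∈ Set.Icc (k * ℓ) ((k + 2) * ℓ)} ∩ G k := by
    rintro ω ⟨⟨h1, h2⟩, hωE⟩
    refine Set.mem_iUnion.2 ⟨⌊a ω / ℓ⌋, ⟨?_, ?_⟩, rfl, hωE⟩
    · exact ((le_div_iff₀ hℓ).1 (Int.floor_le _)).trans h1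
    · have := ((div_lt_iff₀ hℓ).1 (Int.lt_floor_add_one (a ω / ℓ))).le
      linarith
  calc _ ≤ ∑' k : ℤ, P ({ω | D t ω i j ∈ Set.Icc (k * ℓ) ((k + 2) * ℓ)} ∩ G k) :=
        (measure_mono hsub).trans (measure_iUnion_le _)
    _ ≤ ∑' k : ℤ, ENNReal.ofReal κ * ENNReal.ofReal (2 * ℓ) * P (G k) := by
        refine ENNReal.tsum_le_tsum fun k => ?_
        refine (H.smooth t i j hij _ measurableSet_Icc _ (hG k)).trans_eq ?_
        rw [Real.volume_Icc]
        ring_nf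
    _ = ENNReal.ofReal κ * ENNReal.ofReal (2 * ℓ) * P (⋃ k, G k) := by
        rw [ENNReal.tsum_mul_left, measure_iUnion _ fun k => H.otherDistances_le t i j _ (hG k)]
        intro k l hkl
        refine Set.disjoint_left.2 fun ω h1 h2 => hkl (h1.1.symm.trans h2.1)
    _ ≤ _ := by
        gcongr
        exact Set.iUnion_subset fun k => Set.inter_subset_right

/-- The part of a near tie on which `e₁` is the longer one of `e₁, e₂`. -/
lemma IsSmoothAdversary.measure_nearTie_inter_le (H : IsSmoothAdversary P D R κ) (t : ℕ)
    {e₁ e₂ f₁ f₂ : Fin n × Fin n} (he₁ : e₁.1 < e₁.2) (he₂ : e₂.1 < e₂.2) (hf₁ : f₁.1 < f₁.2)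
    (hf₂ : f₂.1 < f₂.2) (h₁ : e₁ ≠ f₁) (h₂ : e₁ ≠ f₂) {α h : ℝ} (hα : 0 < α) (hh : 0 < h)
    {E : Set Ω} (hE : MeasurableSet[H.history t] E) :
    P ({ω | NearTie α h (D t ω e₁.1 e₁.2) (D t ω e₂.1 e₂.2) (D t ω f₁.1 f₁.2) (D t ω f₂.1 f₂.2) ∧
        D t ω e₂.1 e₂.2 ≤ D t ω e₁.1 e₁.2} ∩ E) ≤
      ENNReal.ofReal κ * ENNReal.ofReal (8 * h * (|R| + 1)) * P E := by
  have hE' := H.history_le_otherDistances t e₁.1 e₁.2 _ hE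
  have hnn : ∀ ω (e : Fin n × Fin n), 0 ≤ D t ω e.1 e.2 := fun ω e => (H.mem_Icc t ω _ _).1
  have hR : ∀ ω (e : Fin n × Fin n), D t ω e.1 e.2 ≤ |R| + 1 := fun ω e =>
    (H.mem_Icc t ω _ _).2.trans ((le_abs_self R).trans (by linarith))
  have hℓ : 0 < 4 * h * (|R| + 1) := by positivity
  have m₁ := measurable_otherDistances D t hf₁ h₁.symm
  have m₂ := measurable_otherDistances D t hf₂ h₂.symm
  rw [show 8 * h * (|R| + 1) = 2 * (4 * h * (|R| + 1)) by ring]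
  by_cases he : e₂ = e₁
  · subst he
    refine le_trans (measure_mono ?_) (H.measure_mem_window_le t he₁
      (a := fun ω => windowStartDiag α h (D t ω f₁.1 f₁.2) (D t ω f₂.1 f₂.2)) ?_ hℓ hE')
    · exact Set.inter_subset_inter_left _ fun ω hω =>
        hω.1.mem_Icc_windowStartDiag hα hh.le (hnn _ _) (hnn _ _) (hnn _ _) (hR _ _)
    · exact (((m₁.pow_const α).add (m₂.pow_const α)).div_const _).pow_const _
  · have m₃ := measurable_otherDistances D t he₂ he
    refine le_trans (measure_mono ?_) (H.measure_mem_window_le t he₁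
      (a := fun ω => windowStart α h (D t ω e₂.1 e₂.2) (D t ω f₁.1 f₁.2) (D t ω f₂.1 f₂.2))
      ?_ hℓ hE')
    · exact Set.inter_subset_inter_left _ fun ω hω =>
        hω.1.mem_Icc_windowStart hα hh.le (hnn _ _) hω.2 (hR _ _)
    · exact ((m₃.pow_const α).max
        ((((m₁.pow_const α).add (m₂.pow_const α)).div_const _).sub (m₃.pow_const α))).pow_const _

lemma IsSmoothAdversary.measurableSet_hasNearTie (H : IsSmoothAdversary P D R κ) (α h : ℝ)
    (t : ℕ) : MeasurableSet[H.history (t + 1)] {ω | HasNearTie α h (D t ω)} := by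
  have : {ω | HasNearTie α h (D t ω)} = ⋃ q ∈ pairQuadruples n, {ω | NearTie α h
      (D t ω q.1.1.1 q.1.1.2) (D t ω q.1.2.1 q.1.2.2)
      (D t ω q.2.1.1 q.2.1.2) (D t ω q.2.2.1 q.2.2.2)} := by
    ext ω
    simp [HasNearTie]
  rw [this]
  refine Finset.measurableSet_biUnion _ fun q hq => ?_
  simp only [pairQuadruples, Finset.mem_filter, Finset.mem_univ, true_and] at hq
  have m₁ := (H.measurable_history t hq.1.1).pow_const α
  have m₂ := (H.measurable_history t hq.1.2.1).pow_const α
  have m₃ := (H.measurable_history t hq.1.2.2.1).pow_const α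
  have m₄ := (H.measurable_history t hq.1.2.2.2).pow_const α
  exact MeasurableSet.inter (measurableSet_le (m₁.add m₂) ((m₃.add m₄).const_mul _))
    (measurableSet_le (m₃.add m₄) ((m₁.add m₂).const_mul _))

/-- The bound on the conditional probability of a near tie with tolerance `h`. -/
def nearTieBound (n : ℕ) (R κ h : ℝ) : ℝ :=
  (pairQuadruples n).card * (16 * max κ 0 * (|R| + 1)) * h

lemma IsSmoothAdversary.measure_hasNearTie_inter_le (H : IsSmoothAdversary P D R κ) (t : ℕ)
    {α h : ℝ} (hα : 0 < α) (hh : 0 < h) {E : Set Ω} (hE : MeasurableSet[H.history t] E) :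
    P ({ω | HasNearTie α h (D t ω)} ∩ E) ≤ ENNReal.ofReal (nearTieBound n R κ h) * P E := by
  let b := ENNReal.ofReal κ * ENNReal.ofReal (8 * h * (|R| + 1)) * P E
  let S : (((Fin n × Fin n) × (Fin n × Fin n)) × ((Fin n × Fin n) × (Fin n × Fin n))) → Set Ω :=
    fun q => {ω | NearTie α h
      (D t ω q.1.1.1 q.1.1.2) (D t ω q.1.2.1 q.1.2.2)
      (D t ω q.2.1.1 q.2.1.2) (D t ω q.2.2.1 q.2.2.2)} ∩ E
  have hsub : {ω | HasNearTie α h (D t ω)} ∩ E ⊆ ⋃ q ∈ pairQuadruples n, S q := by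
    rintro ω ⟨⟨q, hq, hω⟩, hωE⟩
    exact Set.mem_biUnion hq ⟨hω, hωE⟩
  have hS : ∀ q ∈ pairQuadruples n, P (S q) ≤ b + b := fun q hq => by
    simp only [pairQuadruples, Finset.mem_filter, Finset.mem_univ, true_and] at hq
    obtain ⟨⟨l₁, l₂, l₃, l₄⟩, n₁, n₂, n₃, n₄⟩ := hq
    refine le_trans (measure_mono ?_) ((measure_union_le _ _).trans (add_le_add
      (H.measure_nearTie_inter_le t l₁ l₂ l₃ l₄ n₁ n₂ hα hh hE)
      (H.measure_nearTie_inter_le t l₂ l₁ l₃ l₄ n₃ n₄ hα hh hE)))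
    rintro ω ⟨hω, hωE⟩
    rcases le_total (D t ω q.1.2.1 q.1.2.2) (D t ω q.1.1.1 q.1.1.2) with hle | hle
    · exact Or.inl ⟨⟨hω, hle⟩, hωE⟩
    · exact Or.inr ⟨⟨hω.swap_left, hle⟩, hωE⟩
  calc _ ≤ ∑ q ∈ pairQuadruples n, P (S q) :=
        (measure_mono hsub).trans (measure_biUnion_finset_le _ _)
    _ ≤ ∑ q ∈ pairQuadruples n, (b + b) := Finset.sum_le_sum hS
    _ = _ := by
        have hκ : ENNReal.ofReal κ = ENNReal.ofReal (max κ 0) := by simp [ENNReal.ofReal_max]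
        have hκ0 : 0 ≤ max κ 0 := le_max_right _ _
        rw [Finset.sum_const, nsmul_eq_mul, ← two_mul, nearTieBound, ← ENNReal.ofReal_natCast]
        change _ * (2 * (ENNReal.ofReal κ * ENNReal.ofReal (8 * h * (|R| + 1)) * P E)) = _
        rw [hκ, ← ENNReal.ofReal_mul hκ0, ← mul_assoc, ← mul_assoc,
          ← ENNReal.ofReal_ofNat 2, ← ENNReal.ofReal_mul (by positivity),
          ← ENNReal.ofReal_mul (by positivity)]
        congr 2
        ring

end Smooth

/-! ### The grid in `1/α` and the final bound -/

/-- Two parameters at distance at most `ε` have inverses `1/x, 1/y` in a common cell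
`[kw, (k+2)w]`, where `w = ε / αmin²`. -/
lemma exists_cell {αmin ε x y : ℝ} (hαmin : 0 < αmin) (hε : 0 < ε) (hx : αmin < x) (hy : αmin < y)
    (hxy : |x - y| ≤ ε) : ∃ k < ⌊αmin / ε⌋₊ + 1,
      1 / ((k + 2) * (ε / αmin ^ 2)) ≤ x ∧ 1 / ((k + 2) * (ε / αmin ^ 2)) ≤ y ∧
      (k + 2) * (ε / αmin ^ 2) ≤ 1 / x + 2 * (ε / αmin ^ 2) ∧
      (k + 2) * (ε / αmin ^ 2) ≤ 1 / y + 2 * (ε / αmin ^ 2) := by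
  -- by symmetry `1/x ≤ 1/y`
  wlog hle : y ≤ x generalizing x y
  · obtain ⟨k, hk, h1, h2, h3, h4⟩ := this hy hx (by rwa [abs_sub_comm]) (le_of_not_ge hle)
    exact ⟨k, hk, h2, h1, h4, h3⟩
  set w := ε / αmin ^ 2 with hw
  have hx0 := hαmin.trans hx
  have hy0 := hαmin.trans hy
  have hw0 : 0 < w := by positivity
  have hinv : 1 / x ≤ 1 / y := one_div_le_one_div_of_le hy0 hle
  have hdist : 1 / y - 1 / x ≤ w := by
    rw [div_sub_div _ _ hy0.ne' hx0.ne', hw]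
    refine div_le_div₀ hε.le ?_ (by positivity) ?_
    · linarith [le_abs_self (x - y)]
    · rw [pow_two]
      exact mul_le_mul hy.le hx.le hαmin.le hy0.le
  have hfl : (⌊1 / x / w⌋₊ : ℝ) * w ≤ 1 / x :=
    (le_div_iff₀ hw0).1 (Nat.floor_le (by positivity))
  have hfl' : 1 / x < (⌊1 / x / w⌋₊ + 1 : ℝ) * w := (div_lt_iff₀ hw0).1 (Nat.lt_floor_add_one _)
  refine ⟨⌊1 / x / w⌋₊, Nat.lt_succ_of_le (Nat.floor_le_floor ?_), ?_, ?_, ?_, ?_⟩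
  · rw [hw, div_le_div_iff₀ (by positivity) hε, ← mul_div_assoc, one_div_mul_eq_div]
    rw [le_div_iff₀ (by positivity), div_mul_eq_mul_div, div_le_iff₀ hx0]
    nlinarith [mul_pos hαmin hε, mul_pos (mul_pos hαmin hε) hαmin]
  · rw [one_div_le (by positivity) hx0]
    linarith
  · rw [one_div_le (by positivity) hy0]
    linarith
  · linarith
  · linarith

lemma exists_two_pow_ge {c z : ℝ} (hz : 0 ≤ z) (hc : Real.log c ≤ z) (hc0 : 0 < c) :
    ∃ a : ℕ, c ≤ 2 ^ a ∧ (a : ℝ) ≤ 2 * z + 1 := by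
  refine ⟨⌈2 * z⌉₊, ?_, (Nat.ceil_lt_add_one (by positivity)).le⟩
  rw [← Real.log_le_log_iff hc0 (by positivity), Real.log_pow]
  have := Nat.le_ceil (2 * z)
  nlinarith [Real.log_two_gt_d9]

end

theorem mainTheorem9 (n : ℕ) (R κ αmin : ℝ) (hαmin : 0 < αmin) :
    ∃ (C : ℝ) (k : ℕ), ∀ (Ω : Type*) [MeasurableSpace Ω] (P : Measure Ω) [IsProbabilityMeasure P]
      (D : ℕ → Ω → Matrix (Fin n) (Fin n) ℝ), IsSmoothAdversary P D R κ →
      ∀ (tie : ℕ → Ω → TieBreak n) (v : ℕ → Ω → ClusterTree n → Set.Icc (0 : ℝ) 1)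
        (L : ℝ), 0 ≤ L →
        IsDispersedWith P (Set.Ioi αmin)
          (fun t ω α => linkageUtility (D t ω) (tie t ω) (v t ω) α) (1 / 2) L C k := by
  -- `b ε` bounds the conditional probability of a near tie in a given cell
  let b := nearTieBound n R κ (2 / αmin ^ 2)
  have hb : 0 ≤ b := by
    have := le_max_right κ 0
    unfold b nearTieBound
    positivity
  have hlogα : 0 ≤ Real.log (αmin + 1) := Real.log_nonneg (by linarith)
  refine ⟨2 * (b + Real.log (αmin + 1) + 1) + 2, 1, ?_⟩
  intro Ω _ P _ D H tie v L hL T hT ε hε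
  have hT1 : (1 : ℝ) ≤ T := by exact_mod_cast hT
  have hT0 : (0 : ℝ) < T := by linarith
  have hlogT : 0 ≤ Real.log T := Real.log_nonneg hT1
  have hε0 : 0 < ε := (Real.rpow_pos_of_pos hT0 _).trans_le hε
  -- only `1/T ≤ ε` is needed of the lower bound on `ε`
  have hεT : 1 ≤ ε * T := by
    have : (T : ℝ) ^ (-1 : ℝ) ≤ ε :=
      (Real.rpow_le_rpow_of_exponent_le hT1 (by norm_num)).trans hε
    rwa [Real.rpow_neg_one, inv_le_iff_one_le_mul₀ hT0] at this
  set M := ⌊αmin / ε⌋₊ + 1 with hM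
  have hMle : (M : ℝ) ≤ (αmin + 1) * T := by
    have h1 : (⌊αmin / ε⌋₊ : ℝ) ≤ αmin / ε := Nat.floor_le (by positivity)
    have h2 : αmin / ε ≤ αmin * T := by
      rw [div_le_iff₀ hε0]
      nlinarith
    rw [hM]
    push_cast
    nlinarith
  have hM0 : (0 : ℝ) < M := by positivity
  set w := ε / αmin ^ 2 with hw
  have hw0 : 0 < w := by positivity
  have hbound : nearTieBound n R κ (2 * w) = b * ε := by
    unfold b nearTieBound
    rw [hw]
    ring
  have hbε : 0 ≤ b * ε := by positivity
  obtain ⟨a, ha, ha'⟩ := exists_two_pow_ge (c := M * (1 + b * ε) ^ T)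
    (z := Real.log (αmin + 1) + Real.log T + T * (b * ε)) (by positivity) (by
      rw [Real.log_mul (by positivity) (by positivity), Real.log_pow,
        ← Real.log_mul (by positivity) (by positivity)]
      have h1 := Real.log_le_log hM0 hMle
      have h2 := Real.log_le_sub_one_of_pos (show 0 < 1 + b * ε by positivity)
      gcongr
      linarith) (by positivity)
  refine (upperExpectation_le_of_le_occurrences (ℱ := H.history)
    (B := fun k t => {ω | HasNearTie (1 / ((k + 2) * w)) (2 * w) (D t ω)})
    (p := ENNReal.ofReal (b * ε)) (M := M) (T := T) (a := a)
    (fun k t => H.measurableSet_hasNearTie _ _ t) (fun k t E hE => ?_) ?_ (fun ω => ?_)).trans ?_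
  · rw [← hbound]
    exact H.measure_hasNearTie_inter_le t (by positivity) (by positivity) hE
  · rw [← ENNReal.ofReal_one, ← ENNReal.ofReal_add zero_le_one hbε,
      ← ENNReal.ofReal_pow (by positivity), ← ENNReal.ofReal_natCast,
      ← ENNReal.ofReal_mul (by positivity), ← ENNReal.ofReal_ofNat 2,
      ← ENNReal.ofReal_pow (by norm_num)]
    exact ENNReal.ofReal_le_ofReal ha
  · refine iSup₂_le fun x hx => iSup₂_le fun y hy => iSup_le fun hxy => ?_
    rw [Real.dist_eq] at hxy
    obtain ⟨k, hk, h1, h2, h3, h4⟩ := exists_cell hαmin hε0 hx hy hxy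
    refine le_trans (Nat.cast_le.2 ?_) (le_iSup₂ (f := fun k (_ : k ∈ Finset.range M) =>
      (occurrences (fun t => {ω | HasNearTie (1 / ((k + 2) * w)) (2 * w) (D t ω)}) T ω : ℝ≥0∞))
      k (Finset.mem_range.2 hk))
    rw [occurrences, ← Set.ncard_coe_finset]
    refine Set.ncard_le_ncard (fun t ht => ?_)
    obtain ⟨htT, hviol⟩ := ht
    simp only [Finset.coe_filter, Finset.mem_range, Set.mem_ofPred_eq]
    refine ⟨htT, ?_⟩
    by_contra hno
    have htree := linkageTree_eq_of_not_hasNearTie (fun i j => (H.mem_Icc t ω i j).1) (H.symm t ω)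
      (tie t ω) (by positivity) h1 h2 (by rwa [one_div_one_div]) (by rwa [one_div_one_div]) hno
    simp only [linkageUtility, htree, sub_self, abs_zero] at hviol
    exact absurd hviol (not_lt.2 (mul_nonneg hL dist_nonneg))
  · rw [← ENNReal.ofReal_natCast, ← ENNReal.ofReal_one, ← ENNReal.ofReal_add (by positivity)
      zero_le_one, pow_one]
    refine ENNReal.ofReal_le_ofReal ?_
    -- `a + 1 ≤ 2 (log (αmin + 1) + log T + bεT) + 2`; every term is absorbed by means of `1 ≤ εT`
    have h1 : 0 ≤ (ε * T - 1) * (Real.log (αmin + 1) + Real.log T + 1) :=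
      mul_nonneg (by linarith) (by positivity)
    have h2 : 0 ≤ ε * T * Real.log T * (b + Real.log (αmin + 1) + 1) := by positivity
    nlinarith
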